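/- Let $Y_i=\theta_{z_i}+w_i\in\mathbb R^d$, $i=1,\dots,n$, where $\theta_1,\dots,\theta_k\in\mathbb R^d$ ($k\ge 2$) and $z_1,\dots,z_n\in[k]$ are fixed and unknown, and $w_1,\dots,w_n$ are independent random vectors that are sub-Gaussian with parameter $\sigma>0$: $\mathbb E\,e^{\langle a,w_i\rangle}\le e^{\sigma^2\|a\|^2/2}$ for all $a\in\mathbb R^d$ (so they have mean zero). Put $n_g^*=|\{i\in[n]:z_i=g\}|$, $\alpha=\min_{g}n_g^*/n$, $\Delta=\min_{g\ne h}\|\theta_g-\theta_h\|_2$, and $\mathsf{SNR}=\Delta/(2\sigma)$. After seeing the data, an adversary adds $n^{\mathsf{out}}=n\alpha(1-\delta)$ points of its choice, where $\delta\in(0,1]$; write $Y_i$ for these points too, $n<i\le n+n^{\mathsf{out}}$. The $k$-medians-hybrid algorithm produces labels $\hat z^{(s)}\in[k]^{n+n^{\mathsf{out}}}$ and centers $\hat\theta^{(s)}_1,\dots,\hat\theta^{(s)}_k$, $s=0,1,2,\dots$. For $s\ge 0$, $$\hat z^{(s+1)}_i\in\operatorname*{argmin}_{h\in[k]}\|Y_i-\hat\theta^{(s)}_h\|_2^2,\qquad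 \hat\theta^{(s+1)}_h=\text{a coordinatewise median of }\{Y_i:\hat z_i^{(s+1)}=h\},$$ over all $n+n^{\mathsf{out}}$ points, with ties broken arbitrarily (and an arbitrary center if the cluster is empty). It is initialized either by labels $\hat z^{(0)}$, with $\hat\theta^{(0)}$ their coordinatewise cluster medians, or by centers $\hat\theta^{(0)}$; both may depend on all the data. Put $$H_0=\min_{g\in[k]}\min\Big\{\frac{n_{gg}}{n_g^*},\frac{n_{gg}}{n_g}\Big\},\quad n_{gg}=|\{i\le n: z_i=\hat z^{(0)}_i=g\}|,\quad n_g=|\{i\le n+n^{\mathsf{out}}:\hat z^{(0)}_i=g\}|,$$ (with $0/0=0$), $\Lambda_0=\max_{h}\|\hat\theta^{(0)}_h-\theta_h\|_2/\Delta$, and $\ell(\hat z^{(s)},z)=\frac1n|\{i\le n:\hat z^{(s)}_i\ne z_i\}|$. There exist absolute constants $C,c_0,c_1,c_2,c_4>0$ such that the following holds. If $n\alpha\ge c_0\log n$ and $\sqrt\delta\,\mathsf{SNR}\sqrt{\alpha/d}>C$, then there is an event of probability at least $$1-4(k^2+k)n^{-4}-16dn^4e^{-0.3n}-2k^2e^{-\mathsf{SNR}/4}$$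 on which, for every choice of the added points, every initialization satisfying $$H_0\ge\frac12+\frac{c_1}{\big(\mathsf{SNR}\sqrt{\alpha/d}\big)^2}\ \text{(labels)}\quad\text{or}\quad\Lambda_0\le\frac12-\frac{c_2}{\Big(\sqrt\delta\,\mathsf{SNR}\sqrt{\frac{\alpha}{1+dk/n}}\Big)^{1/2}}\ \text{(labels or centers)},$$ and every resulting run of the algorithm, $$\ell(\hat z^{(s)},z)\le\exp\Big\{-\frac12\Big(1-\frac{c_4}{(\sqrt\delta\,\mathsf{SNR}\sqrt{\alpha/d})^{1/2}}\Big)\mathsf{SNR}^2\Big\}\qquad\text{for all }s\ge 2.$$ -/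

import Mathlib

open MeasureTheory ProbabilityTheory Finset

noncomputable section

namespace RobustClustering

/-- Points of `ℝ^d` with the Euclidean norm. -/
abbrev Pt (d : ℕ) : Type := EuclideanSpace ℝ (Fin d)

/-- `w` is a sub-Gaussian random vector with parameter `σ`:
`E exp ⟨a, w⟩ ≤ exp (σ² ‖a‖² / 2)` for every `a` (in particular the expectation is finite).
This forces `w` to have mean zero. -/
def IsSubGaussian {Ω : Type*} [MeasurableSpace Ω] {d : ℕ} (σ : ℝ) (w : Ω → Pt d)
    (μ : Measure Ω) : Prop :=
  ∀ a : Pt d, Integrable (fun ω => Real.exp (inner ℝ a (w ω))) μ ∧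
    ∫ ω, Real.exp (inner ℝ a (w ω)) ∂μ ≤ Real.exp (σ ^ 2 * ‖a‖ ^ 2 / 2)

/-- The full data set: the points `θ_{z_i} + w_i` of the mixture (left summand), followed by the
points added by the adversary (right summand). -/
def data {d k n m : ℕ} (θ : Fin k → Pt d) (z : Fin n → Fin k) (w : Fin n → Pt d)
    (x : Fin m → Pt d) : Fin n ⊕ Fin m → Pt d :=
  Sum.elim (fun i => θ (z i) + w i) x

/-- `n_g^*`, the number of mixture points whose true label is `g`. -/
def trueSize {k n : ℕ} (z : Fin n → Fin k) (g : Fin k) : ℕ :=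
  #{i : Fin n | z i = g}

/-- `n_g^{(s)}`, the number of data points, added points included, that the labelling `zh`
puts into cluster `g`. -/
def estSize {k n m : ℕ} (zh : Fin n ⊕ Fin m → Fin k) (g : Fin k) : ℕ :=
  #{i : Fin n ⊕ Fin m | zh i = g}

/-- `n_{gg}^{(s)}`, the number of mixture points with true label `g` that `zh` labels `g`. -/
def correctSize {k n m : ℕ} (z : Fin n → Fin k) (zh : Fin n ⊕ Fin m → Fin k) (g : Fin k) : ℕ :=
  #{i : Fin n | z i = g ∧ zh (Sum.inl i) = g}

/-- `α`, the smallest proportion of mixture points that belong to one component. -/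
def minFraction {k n : ℕ} (z : Fin n → Fin k) : ℝ :=
  ⨅ g : Fin k, (trueSize z g : ℝ) / n

/-- `Δ`, the minimum distance between two of the centers (used for `k ≥ 2`). -/
def separation {d k : ℕ} (θ : Fin k → Pt d) : ℝ :=
  ⨅ p : {p : Fin k × Fin k // p.1 ≠ p.2}, ‖θ p.1.1 - θ p.1.2‖

/-- The signal-to-noise ratio `Δ / (2σ)`. -/
def snr {d k : ℕ} (σ : ℝ) (θ : Fin k → Pt d) : ℝ :=
  separation θ / (2 * σ)

/-- `ℓ`, the proportion of mixture points that are mislabelled. -/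
def mislabelRate {k n m : ℕ} (z : Fin n → Fin k) (zh : Fin n ⊕ Fin m → Fin k) : ℝ :=
  (#{i : Fin n | zh (Sum.inl i) ≠ z i} : ℝ) / n

/-- `H`, the cluster-wise correct labelling proportion. -/
def correctProportion {k n m : ℕ} (z : Fin n → Fin k) (zh : Fin n ⊕ Fin m → Fin k) : ℝ :=
  ⨅ g : Fin k, min ((correctSize z zh g : ℝ) / trueSize z g)
    ((correctSize z zh g : ℝ) / estSize zh g)

/-- `Λ`, the largest error of an estimated center, relative to `Δ`. -/
def centerError {d k : ℕ} (θ θh : Fin k → Pt d) : ℝ :=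
  ⨆ h : Fin k, ‖θh h - θ h‖ / separation θ

/-- `c` is a median of the numbers `v i`, `i ∈ S`: at least half of them are `≤ c` and at least
half of them are `≥ c`. For an even number of values every usual convention (lower or upper
median, midpoint) is covered; for `S = ∅` every `c` is allowed. -/
def IsMedian {ι : Type*} (S : Finset ι) (v : ι → ℝ) (c : ℝ) : Prop :=
  #S ≤ 2 * #{i ∈ S | v i ≤ c} ∧ #S ≤ 2 * #{i ∈ S | c ≤ v i}

/-- `θh` consists of coordinatewise medians of the clusters defined by the labelling `zh`. -/
def IsMedianCenters {ι : Type*} [Fintype ι] {d k : ℕ} (Y : ι → Pt d) (zh : ι → Fin k)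
    (θh : Fin k → Pt d) : Prop :=
  ∀ (h : Fin k) (j : Fin d), IsMedian {i : ι | zh i = h} (fun i => Y i j) (θh h j)

/-- `zh` assigns every data point to a nearest center in Euclidean distance, with ties broken in
any way. -/
def IsNearestLabelling {ι : Type*} {d k : ℕ} (Y : ι → Pt d) (θh : Fin k → Pt d)
    (zh : ι → Fin k) : Prop :=
  ∀ (i : ι) (h : Fin k), ‖Y i - θh (zh i)‖ ^ 2 ≤ ‖Y i - θh h‖ ^ 2

/-- `(zh s, θh s)`, `s = 0, 1, 2, …`, are the labels and centers produced by the
k-medians-hybrid algorithm on the data `Y`, after its initialization at `s = 0`: the labels at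
step `s + 1` are nearest-center labels for the centers of step `s`, and the centers at step
`s + 1` are coordinatewise medians of the clusters at step `s + 1`. -/
structure IsHybridRun {ι : Type*} [Fintype ι] {d k : ℕ} (Y : ι → Pt d)
    (zh : ℕ → ι → Fin k) (θh : ℕ → Fin k → Pt d) : Prop where
  label : ∀ s, IsNearestLabelling Y (θh s) (zh (s + 1))
  center : ∀ s, IsMedianCenters Y (zh (s + 1)) (θh (s + 1))

end RobustClustering

end

/-! The difficulty is that the estimated centers depend on the noise, on the initialization and on
the adversary, so no tail bound applies in the random direction joining two of them. All randomness
is therefore put into three events about the noise alone, fixed before the added points and the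
initialization are chosen; on their complement the analysis is deterministic.

Contraction. A mislabelled point has large noise along the difference of two estimated centers
(`IsNearestLabelling.le_inner`). A bound on the quadratic forms of each component's noise in all
directions at once (`exists_quadraticBound`) then limits how many points of one component can be
given the label of another, whatever the direction. At most `nα(1 - δ)` points are added, so for
centers within `(1/2 - ε)Δ` the correctly labelled points exceed half of every cluster by a multiple
of `δ n_g^*` (`QuadraticBound.margin`). A median of such a cluster can be far off only if many
genuine noise coordinates are large, which the bound on the mean squares of the coordinates forbids
(`exists_coordBound`, `IsMedianCenters.norm_sub_sq_mul_le`). So one step brings the centers within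
`2Δ/ν`, with `ν = √δ SNR √(α/d)`, and this persists.

Sharp rate. Once the centers are that accurate, replacing them by the true ones costs only `O(1/ν)`
in the threshold of a mislabelling event, except for very long noise vectors. The resulting event
`IsLargeNoise` depends only on the noise of the point itself, so one count bounds the errors of all
later steps. Its expectation has the exponent `SNR²/2` up to the factor `1 - 40/ν`, and Markov's
inequality controls the count (`exists_card_isLargeNoise_le`). -/

noncomputable section

namespace RobustClustering

/-! ### Exponential moments and tails of sub-Gaussian projections -/

/-- `exp (x² / (4 σ²))` is a mixture of the exponentials `exp (x y)`. -/
lemma lintegral_exp_mul_sub_sq {σ : ℝ} (hσ : 0 < σ) (x : ℝ) :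
    ∫⁻ y : ℝ, ENNReal.ofReal (Real.exp (y * x - σ ^ 2 * y ^ 2)) =
      ENNReal.ofReal (√(Real.pi / σ ^ 2)) * ENNReal.ofReal (Real.exp (x ^ 2 / (4 * σ ^ 2))) := by
  have h1 : ∀ y : ℝ, Real.exp (y * x - σ ^ 2 * y ^ 2) =
      Real.exp (-(σ ^ 2) * (y - x / (2 * σ ^ 2)) ^ 2) * Real.exp (x ^ 2 / (4 * σ ^ 2)) := by
    intro y
    rw [← Real.exp_add]
    congr 1
    field_simp
    ring
  simp_rw [h1, ENNReal.ofReal_mul (Real.exp_nonneg _)]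
  rw [lintegral_mul_const' _ _ ENNReal.ofReal_ne_top,
    lintegral_sub_right_eq_self
      (fun y : ℝ => ENNReal.ofReal (Real.exp (-(σ ^ 2) * y ^ 2))) (x / (2 * σ ^ 2)),
    ← ofReal_integral_eq_lintegral_ofReal (integrable_exp_neg_mul_sq (by positivity))
      (ae_of_all _ fun _ => (Real.exp_pos _).le), integral_gaussian]

/-- By Tonelli the Gaussian mixture reduces the square to linear exponents: the moment bound leaves
`exp (-σ² y² / 2)` in place of `exp (-σ² y²)`, and the two Gaussian integrals have ratio `√2`. -/
lemma lintegral_exp_sq_le {Ω : Type*} [MeasurableSpace Ω] {μ : Measure Ω} [SFinite μ] {σ : ℝ}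
    (hσ : 0 < σ) {X : Ω → ℝ} (hX : Measurable X)
    (hint : ∀ t : ℝ, Integrable (fun ω => Real.exp (t * X ω)) μ)
    (hmgf : ∀ t : ℝ, ∫ ω, Real.exp (t * X ω) ∂μ ≤ Real.exp (σ ^ 2 * t ^ 2 / 2)) :
    ∫⁻ ω, ENNReal.ofReal (Real.exp (X ω ^ 2 / (4 * σ ^ 2))) ∂μ ≤ ENNReal.ofReal (√2) := by
  set c := ENNReal.ofReal (√(Real.pi / σ ^ 2)) with hc
  have hpos : 0 < √(Real.pi / σ ^ 2) := by
    have := Real.pi_pos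
    positivity
  have hc0 : c ≠ 0 := by
    rw [hc, Ne, ENNReal.ofReal_eq_zero, not_le]
    exact hpos
  have hct : c ≠ ⊤ := ENNReal.ofReal_ne_top
  have key : c * ∫⁻ ω, ENNReal.ofReal (Real.exp (X ω ^ 2 / (4 * σ ^ 2))) ∂μ ≤
      c * ENNReal.ofReal (√2) := by
    rw [← lintegral_const_mul' _ _ hct]
    simp_rw [hc, ← lintegral_exp_mul_sub_sq hσ]
    rw [lintegral_lintegral_swap (by fun_prop)]
    calc ∫⁻ y : ℝ, ∫⁻ ω, ENNReal.ofReal (Real.exp (y * X ω - σ ^ 2 * y ^ 2)) ∂μ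
        ≤ ∫⁻ y : ℝ, ENNReal.ofReal (Real.exp (-(σ ^ 2 / 2) * y ^ 2)) := by
          refine lintegral_mono fun y => ?_
          simp_rw [sub_eq_add_neg, Real.exp_add, ENNReal.ofReal_mul (Real.exp_nonneg _)]
          rw [lintegral_mul_const' _ _ ENNReal.ofReal_ne_top,
            ← ofReal_integral_eq_lintegral_ofReal (hint y)
              (ae_of_all _ fun _ => (Real.exp_pos _).le), ← ENNReal.ofReal_mul' (Real.exp_nonneg _)]
          refine ENNReal.ofReal_le_ofReal ?_
          calc _ ≤ Real.exp (σ ^ 2 * y ^ 2 / 2) * Real.exp (-(σ ^ 2 * y ^ 2)) := by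
                gcongr; exact hmgf y
            _ = _ := by rw [← Real.exp_add]; congr 1; ring
      _ = c * ENNReal.ofReal (√2) := by
          rw [← ofReal_integral_eq_lintegral_ofReal (integrable_exp_neg_mul_sq (by positivity))
            (ae_of_all _ fun _ => (Real.exp_pos _).le), integral_gaussian, hc,
            ← ENNReal.ofReal_mul hpos.le, ← Real.sqrt_mul (by have := Real.pi_pos; positivity)]
          congr 2
          field_simp
  exact (ENNReal.mul_le_mul_iff_right hc0 hct).1 key

section SubGaussian

variable {Ω : Type*} [MeasurableSpace Ω] {μ : Measure Ω} {d : ℕ} {σ : ℝ}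

lemma IsSubGaussian.integrable_exp_mul_inner {w : Ω → Pt d} (hw : IsSubGaussian σ w μ)
    (u : Pt d) (t : ℝ) : Integrable (fun ω => Real.exp (t * inner ℝ u (w ω))) μ := by
  simpa [real_inner_smul_left] using (hw (t • u)).1

lemma IsSubGaussian.mgf_inner_le {w : Ω → Pt d} (hw : IsSubGaussian σ w μ) (u : Pt d) (t : ℝ) :
    mgf (fun ω => inner ℝ u (w ω)) μ t ≤ Real.exp (σ ^ 2 * (t * ‖u‖) ^ 2 / 2) := by
  simpa [real_inner_smul_left, norm_smul, mul_pow, mgf] using (hw (t • u)).2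

/-- Chernoff's bound for the projections of a sub-Gaussian vector. -/
lemma IsSubGaussian.measureReal_inner_ge_le [IsProbabilityMeasure μ] {w : Ω → Pt d}
    (hw : IsSubGaussian σ w μ) (hσ : 0 < σ) {u : Pt d} {r : ℝ} (hr : 0 < r) (hu : ‖u‖ ≤ r)
    {t : ℝ} (ht : 0 ≤ t) :
    μ.real {ω | t ≤ inner ℝ u (w ω)} ≤ Real.exp (-(t ^ 2 / (2 * σ ^ 2 * r ^ 2))) := by
  -- This parameter minimizes `-λ t + σ² λ² r² / 2` over `λ`.
  refine (measure_ge_le_exp_mul_mgf (t := t / (σ ^ 2 * r ^ 2)) t (by positivity)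
    (hw.integrable_exp_mul_inner u _)).trans ?_
  calc _ ≤ Real.exp (-(t / (σ ^ 2 * r ^ 2)) * t) *
        Real.exp (σ ^ 2 * (t / (σ ^ 2 * r ^ 2) * r) ^ 2 / 2) := by
        gcongr
        refine (hw.mgf_inner_le u _).trans ?_
        gcongr
    _ = _ := by
        rw [← Real.exp_add]
        congr 1
        field_simp
        ring

lemma sqrt_two_le_exp_half : √2 ≤ Real.exp (1 / 2) := by
  rw [Real.sqrt_le_left (Real.exp_nonneg _), ← Real.exp_nat_mul]
  have := Real.add_one_le_exp 1
  norm_num at this ⊢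
  linarith

lemma IsSubGaussian.integrable_exp_inner_sq [SFinite μ] {w : Ω → Pt d} (hw : IsSubGaussian σ w μ)
    (hσ : 0 < σ) (hm : Measurable w) {u : Pt d} (hu : ‖u‖ ≤ 1) :
    Integrable (fun ω => Real.exp (1 / (4 * σ ^ 2) * inner ℝ u (w ω) ^ 2)) μ ∧
      mgf (fun ω => inner ℝ u (w ω) ^ 2) μ (1 / (4 * σ ^ 2)) ≤ Real.exp (1 / 2) := by
  have hmeas : Measurable fun ω => inner ℝ u (w ω) := by fun_prop
  have h := lintegral_exp_sq_le (μ := μ) hσ hmeas (hw.integrable_exp_mul_inner u) (fun t => by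
    refine (hw.mgf_inner_le u t).trans (Real.exp_le_exp.2 ?_)
    have : (t * ‖u‖) ^ 2 ≤ t ^ 2 := by
      rw [mul_pow]
      exact mul_le_of_le_one_right (sq_nonneg _) (pow_le_one₀ (norm_nonneg _) hu)
    gcongr)
  simp_rw [div_eq_inv_mul (_ ^ 2), ← one_div] at h
  have hint : Integrable (fun ω => Real.exp (1 / (4 * σ ^ 2) * inner ℝ u (w ω) ^ 2)) μ := by
    refine ⟨by fun_prop, ?_⟩
    rw [hasFiniteIntegral_iff_ofReal (ae_of_all _ fun _ => (Real.exp_pos _).le)]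
    exact h.trans_lt ENNReal.ofReal_lt_top
  refine ⟨hint, le_trans ?_ sqrt_two_le_exp_half⟩
  rw [← ofReal_integral_eq_lintegral_ofReal hint (ae_of_all _ fun _ => (Real.exp_pos _).le),
    ENNReal.ofReal_le_ofReal_iff (by positivity)] at h
  exact h

/-- Tail bound for the sum of the squared projections of independent sub-Gaussian vectors. -/
lemma measureReal_sum_inner_sq_ge_le [IsProbabilityMeasure μ] {ι : Type*} {w : ι → Ω → Pt d}
    (hσ : 0 < σ) (hm : ∀ i, Measurable (w i)) (hind : iIndepFun w μ)
    (hw : ∀ i, IsSubGaussian σ (w i) μ) (T : Finset ι) {u : Pt d} (hu : ‖u‖ ≤ 1) (t : ℝ) :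
    μ.real {ω | t * σ ^ 2 ≤ ∑ i ∈ T, inner ℝ u (w i ω) ^ 2} ≤ Real.exp (#T / 2 - t / 4) := by
  set X : ι → Ω → ℝ := fun i ω => inner ℝ u (w i ω) ^ 2 with hX
  have hXm : ∀ i, Measurable (X i) := fun i => by
    have := hm i
    fun_prop
  have hXind : iIndepFun X μ :=
    hind.comp (fun _ v => inner ℝ u v ^ 2) (fun _ => by fun_prop)
  have h0 : {ω | t * σ ^ 2 ≤ ∑ i ∈ T, inner ℝ u (w i ω) ^ 2} =
      {ω | t * σ ^ 2 ≤ (∑ i ∈ T, X i) ω} := by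
    ext ω
    simp [hX]
  rw [h0]
  refine (measure_ge_le_exp_mul_mgf (t := 1 / (4 * σ ^ 2)) _ (by positivity)
    (hXind.integrable_exp_mul_sum hXm
      fun i _ => ((hw i).integrable_exp_inner_sq hσ (hm i) hu).1)).trans ?_
  rw [hXind.mgf_sum hXm]
  calc _ ≤ Real.exp (-(1 / (4 * σ ^ 2)) * (t * σ ^ 2)) * ∏ _i ∈ T, Real.exp (1 / 2) := by
        gcongr with i _
        · exact fun i _ => mgf_nonneg
        · exact ((hw i).integrable_exp_inner_sq hσ (hm i) hu).2
    _ = _ := by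
        rw [prod_const, ← Real.exp_nat_mul, ← Real.exp_add]
        congr 1
        field_simp
        ring

end SubGaussian

/-! ### Nets of the unit ball -/

/-- A finite `1/2`-net of the Euclidean unit ball. -/
lemma exists_net (d : ℕ) : ∃ s : Finset (Pt d), #s ≤ 5 ^ d ∧ (∀ u ∈ s, ‖u‖ ≤ 1) ∧
    ∀ x : Pt d, ‖x‖ ≤ 1 → ∃ u ∈ s, ‖x - u‖ ≤ 1 / 2 := by
  classical
  let P : ℕ → Prop := fun N => ∃ s : Finset (Pt d), #s = N ∧ (∀ c ∈ s, ‖c‖ ≤ 2) ∧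
    ∀ c ∈ s, ∀ e ∈ s, c ≠ e → 1 ≤ ‖c - e‖
  have hb : ∀ N, P N → N ≤ 5 ^ d := by
    rintro N ⟨s, rfl, h1, h2⟩
    simpa using Besicovitch.card_le_of_separated s h1 h2
  have h0 : P 0 := ⟨∅, by simp⟩
  -- A `1`-separated subset of the ball of radius `2` of largest cardinality covers that ball at
  -- distance `1`, since otherwise a point could be added; halving it gives the net.
  obtain ⟨s, hs, h1, h2⟩ := Nat.findGreatest_spec (Nat.zero_le (5 ^ d)) h0
  refine ⟨s.image fun c => (1 / 2 : ℝ) • c, card_image_le.trans (hs ▸ hb _ ⟨s, hs, h1, h2⟩), ?_, ?_⟩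
  · simp only [mem_image, forall_exists_index, and_imp, forall_apply_eq_imp_iff₂]
    intro c hc
    rw [norm_smul]
    have := h1 c hc
    norm_num
    linarith
  · intro x hx
    have hx2 : ‖(2 : ℝ) • x‖ ≤ 2 := by
      rw [norm_smul]
      norm_num
      linarith
    suffices ∃ c ∈ s, ‖(2 : ℝ) • x - c‖ ≤ 1 by
      obtain ⟨c, hc, hxc⟩ := this
      refine ⟨(1 / 2 : ℝ) • c, mem_image_of_mem _ hc, ?_⟩
      have : x - (1 / 2 : ℝ) • c = (1 / 2 : ℝ) • ((2 : ℝ) • x - c) := by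
        rw [smul_sub, smul_smul]
        norm_num
      rw [this, norm_smul]
      norm_num
      linarith
    by_contra! hcon
    have hmem : (2 : ℝ) • x ∉ s := fun h => by
      have := hcon _ h
      norm_num at this
    have hP : P (#s + 1) := by
      refine ⟨insert ((2 : ℝ) • x) s, card_insert_of_notMem hmem, ?_, ?_⟩
      · simp only [mem_insert, forall_eq_or_imp]
        exact ⟨hx2, h1⟩
      · intro c hc e he hne
        rw [mem_insert] at hc he
        rcases hc with rfl | hc <;> rcases he with rfl | he
        · exact absurd rfl hne
        · exact (hcon e he).le
        · rw [norm_sub_rev]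
          exact (hcon c hc).le
        · exact h2 c hc e he hne
    have := Nat.le_findGreatest (hb _ hP) hP
    omega

lemma norm_le_two_mul_of_net {d : ℕ} {s : Finset (Pt d)}
    (hs : ∀ x : Pt d, ‖x‖ ≤ 1 → ∃ u ∈ s, ‖x - u‖ ≤ 1 / 2) (v : Pt d) :
    ∃ u ∈ s, ‖v‖ ≤ 2 * inner ℝ u v := by
  rcases eq_or_ne v 0 with rfl | hv
  · obtain ⟨u, hu, -⟩ := hs 0 (by simp)
    exact ⟨u, hu, by simp⟩
  · have hv' : ‖v‖ ≠ 0 := norm_ne_zero_iff.2 hv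
    obtain ⟨u, hu, h⟩ := hs (‖v‖⁻¹ • v) (by rw [norm_smul]; simp [hv'])
    refine ⟨u, hu, ?_⟩
    have h1 : inner ℝ (‖v‖⁻¹ • v - u) v ≤ 1 / 2 * ‖v‖ :=
      (real_inner_le_norm _ _).trans (by gcongr)
    rw [inner_sub_left, real_inner_smul_left, real_inner_self_eq_norm_sq] at h1
    have h2 : ‖v‖⁻¹ * ‖v‖ ^ 2 = ‖v‖ := by field_simp
    linarith

/-- A bound for a quadratic form on a `1/2`-net extends to the whole space. -/
lemma sum_inner_sq_le_of_net {ι : Type*} {d : ℕ} {s : Finset (Pt d)}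
    (hs : ∀ x : Pt d, ‖x‖ ≤ 1 → ∃ u ∈ s, ‖x - u‖ ≤ 1 / 2) (T : Finset ι) (w : ι → Pt d) {M : ℝ}
    (hM : ∀ u ∈ s, ∑ i ∈ T, inner ℝ u (w i) ^ 2 ≤ M) (x : Pt d) :
    ∑ i ∈ T, inner ℝ x (w i) ^ 2 ≤ 4 * M * ‖x‖ ^ 2 := by
  let L₀ : Pt d →ₗ[ℝ] EuclideanSpace ℝ T :=
    { toFun := fun x => WithLp.toLp 2 fun i : T => inner ℝ x (w i)
      map_add' := fun x y => by ext i; simp [inner_add_left]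
      map_smul' := fun c x => by ext i; simp [real_inner_smul_left] }
  let L : Pt d →L[ℝ] EuclideanSpace ℝ T := LinearMap.toContinuousLinearMap L₀
  have hL : ∀ x, ‖L x‖ ^ 2 = ∑ i ∈ T, inner ℝ x (w i) ^ 2 := fun x => by
    rw [EuclideanSpace.real_norm_sq_eq, ← Finset.sum_coe_sort T]
    rfl
  have hM0 : 0 ≤ M := by
    obtain ⟨u, hu, -⟩ := hs 0 (by simp)
    exact (sum_nonneg fun i _ => sq_nonneg _).trans (hM u hu)
  have hLs : ∀ u ∈ s, ‖L u‖ ≤ √M := fun u hu => Real.le_sqrt_of_sq_le ((hL u).trans_le (hM u hu))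
  have hball : ∀ y : Pt d, ‖y‖ ≤ 1 → ‖L y‖ ≤ √M + ‖L‖ / 2 := fun y hy => by
    obtain ⟨u, hu, h⟩ := hs y hy
    calc ‖L y‖ = ‖L u + L (y - u)‖ := by rw [← map_add]; simp
      _ ≤ ‖L u‖ + ‖L‖ * ‖y - u‖ := (norm_add_le _ _).trans (by gcongr; exact L.le_opNorm _)
      _ ≤ √M + ‖L‖ * (1 / 2) := by gcongr; exact hLs u hu
      _ = _ := by ring
  -- The operator norm bounds itself, which yields `‖L‖ ≤ 2 √M`.
  have hop : ‖L‖ ≤ √M + ‖L‖ / 2 := by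
    refine L.opNorm_le_bound (by positivity) fun y => ?_
    rcases eq_or_ne y 0 with rfl | hy
    · simp
    · have hy' : ‖y‖ ≠ 0 := norm_ne_zero_iff.2 hy
      have := hball (‖y‖⁻¹ • y) (by rw [norm_smul]; simp [hy'])
      rw [map_smul, norm_smul, norm_inv, norm_norm] at this
      rwa [inv_mul_le_iff₀ (by positivity), mul_comm] at this
  rw [← hL]
  calc ‖L x‖ ^ 2 ≤ (‖L‖ * ‖x‖) ^ 2 := by gcongr; exact L.le_opNorm x
    _ ≤ (2 * √M * ‖x‖) ^ 2 := by gcongr; linarith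
    _ = 4 * M * ‖x‖ ^ 2 := by rw [mul_pow, mul_pow, Real.sq_sqrt hM0]; ring

/-! ### Separation, center error and component sizes -/

lemma separation_le {d k : ℕ} (θ : Fin k → Pt d) {g h : Fin k} (hgh : g ≠ h) :
    separation θ ≤ ‖θ g - θ h‖ :=
  ciInf_le (Set.finite_range _).bddBelow
    (⟨(g, h), hgh⟩ : {p : Fin k × Fin k // p.1 ≠ p.2})

lemma centerError_mul_le {d k : ℕ} {θ θh : Fin k → Pt d} (hΔ : 0 < separation θ) {r : ℝ}
    (h : centerError θ θh ≤ r) (g : Fin k) : ‖θh g - θ g‖ ≤ r * separation θ := by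
  rw [← div_le_iff₀ hΔ]
  exact (le_ciSup (Set.finite_range fun h => ‖θh h - θ h‖ / separation θ).bddAbove g).trans h

lemma minFraction_mul_le {k n : ℕ} (z : Fin n → Fin k) (g : Fin k) :
    n * minFraction z ≤ trueSize z g := by
  rcases Nat.eq_zero_or_pos n with rfl | hn
  · simp
  · have : minFraction z ≤ (trueSize z g : ℝ) / n :=
      ciInf_le (Set.finite_range fun g => (trueSize z g : ℝ) / n).bddBelow g
    rw [le_div_iff₀ (by positivity)] at this
    linarith

lemma sum_trueSize {k n : ℕ} (z : Fin n → Fin k) : ∑ g, (trueSize z g : ℝ) = n := by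
  have := card_eq_sum_card_fiberwise (f := z) (s := univ) (t := univ) (fun _ _ => mem_univ _)
  rw [card_fin] at this
  exact_mod_cast this.symm

lemma card_mul_minFraction_le {k n : ℕ} (z : Fin n → Fin k) :
    (n * minFraction z) * k ≤ n := by
  have := sum_le_sum fun g (_ : g ∈ univ) => minFraction_mul_le z g
  rw [sum_trueSize, sum_const, card_fin, nsmul_eq_mul] at this
  linarith

/-! ### Deterministic analysis of one labelling and one median step -/

section Labelling

variable {d k n m : ℕ} {θ θh : Fin k → Pt d} {z : Fin n → Fin k} {w : Fin n → Pt d}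
  {x : Fin m → Pt d} {zh : Fin n ⊕ Fin m → Fin k}

/-- A mislabelled point has large noise in the direction of the wrong estimated center. -/
lemma IsNearestLabelling.le_inner (hzh : IsNearestLabelling (data θ z w x) θh zh) {r : ℝ}
    (hr0 : 0 ≤ r) (hr : r ≤ 1 / 2) (hΔ : 0 < separation θ)
    (hθh : ∀ g, ‖θh g - θ g‖ ≤ r * separation θ) {i : Fin n} (hi : zh (Sum.inl i) ≠ z i) :
    ‖θ (zh (Sum.inl i)) - θ (z i)‖ ^ 2 * (1 / 2 - r) ≤
      inner ℝ (θh (zh (Sum.inl i)) - θh (z i)) (w i) := by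
  have h := hzh (Sum.inl i) (z i)
  simp only [data, Sum.elim_inl] at h
  have hD := separation_le θ hi
  have hg := hθh (z i)
  have hh := hθh (zh (Sum.inl i))
  set a := θ (z i)
  set b := θ (zh (Sum.inl i))
  set a' := θh (z i)
  set b' := θh (zh (Sum.inl i))
  set Δ := separation θ
  rw [show a + w i - b' = (a - b') + w i by abel, show a + w i - a' = (a - a') + w i by abel,
    norm_add_sq_real, norm_add_sq_real] at h
  have h1 : inner ℝ (b' - a') (w i) = inner ℝ (a - a') (w i) - inner ℝ (a - b') (w i) := by
    rw [← inner_sub_left]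
    congr 1
    abel
  rw [norm_sub_rev] at hg
  have h2 : ‖b - a‖ - r * Δ ≤ ‖a - b'‖ := by
    have := norm_add_le (b - b') (b' - a)
    rw [sub_add_sub_cancel] at this
    rw [norm_sub_rev a b']
    rw [norm_sub_rev b' b] at hh
    linarith
  have h3 : r * Δ ≤ ‖b - a‖ := by nlinarith
  have h4 : (‖b - a‖ - r * Δ) ^ 2 ≤ ‖a - b'‖ ^ 2 := by
    gcongr
  have h5 : ‖a - a'‖ ^ 2 ≤ (r * Δ) ^ 2 := by gcongr
  have h6 : r * ‖b - a‖ * Δ ≤ r * ‖b - a‖ * ‖b - a‖ := by gcongr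
  -- With `D = ‖b - a‖`, twice the inner product is at least `(D - rΔ)² - (rΔ)² = D² - 2rΔD ≥ D² (1
  -- - 2r)`.
  nlinarith

/-- The number of points with true label `g` that are labelled `h`. -/
def confusion (z : Fin n → Fin k) (zh : Fin n ⊕ Fin m → Fin k) (g h : Fin k) : ℕ :=
  #{i : Fin n | z i = g ∧ zh (Sum.inl i) = h}

/-- The quadratic forms of the noise of each component are bounded in all directions. -/
def QuadraticBound (σ : ℝ) (z : Fin n → Fin k) (w : Fin n → Pt d) : Prop :=
  ∀ (g : Fin k) (u : Pt d), ∑ i with z i = g, inner ℝ u (w i) ^ 2 ≤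
    32 * (trueSize z g + d) * σ ^ 2 * ‖u‖ ^ 2

/-- Every confused point contributes at least `(ε D²)²` to the quadratic form in the direction `θh h
- θh g`, whose length is at most `2D`. As `QuadraticBound` holds in all directions, the dependence
of this one on the data is harmless. -/
lemma QuadraticBound.confusion_mul_le {σ : ℝ} (hq : QuadraticBound σ z w) (hσ : 0 < σ)
    (hzh : IsNearestLabelling (data θ z w x) θh zh) {ε : ℝ}
    (hε0 : 0 ≤ ε) (hε : ε ≤ 1 / 2) (hΔ : 0 < separation θ)
    (hθh : ∀ g, ‖θh g - θ g‖ ≤ (1 / 2 - ε) * separation θ) {g h : Fin k} (hgh : g ≠ h) :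
    confusion z zh g h * (ε * snr σ θ) ^ 2 ≤ 32 * (trueSize z g + d) := by
  set D := ‖θ h - θ g‖ with hD
  have hΔD : separation θ ≤ D := separation_le θ hgh.symm
  have hDpos : 0 < D := hΔ.trans_le hΔD
  have hv : ‖θh h - θh g‖ ≤ 2 * D := by
    have h1 : θh h - θh g = (θh h - θ h) + (θ h - θ g) - (θh g - θ g) := by abel
    have h2 := hθh h
    have h3 := hθh g
    rw [h1]
    refine (norm_sub_le _ _).trans ((add_le_add_left (norm_add_le _ _) _).trans ?_)
    nlinarith
  have hcount : confusion z zh g h * (ε * D ^ 2) ^ 2 ≤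
      ∑ i with z i = g, inner ℝ (θh h - θh g) (w i) ^ 2 := by
    rw [confusion, ← nsmul_eq_mul, ← sum_const]
    have hsub : ({i : Fin n | z i = g ∧ zh (Sum.inl i) = h} : Finset (Fin n)) ⊆
        ({i : Fin n | z i = g} : Finset (Fin n)) := fun i hi => by
      simp only [mem_filter] at hi ⊢
      tauto
    refine le_trans (sum_le_sum fun i hi => ?_)
      (sum_le_sum_of_subset_of_nonneg hsub fun i _ _ => sq_nonneg _)
    obtain ⟨rfl, rfl⟩ : z i = g ∧ zh (Sum.inl i) = h := by simpa using hi
    have := hzh.le_inner (by linarith) (by linarith) hΔ hθh hgh.symm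
    gcongr
    linarith
  have h1 : confusion z zh g h * (ε * D ^ 2) ^ 2 ≤
      32 * (trueSize z g + d) * σ ^ 2 * (2 * D) ^ 2 :=
    hcount.trans ((hq g _).trans (by gcongr))
  have h2 : (confusion z zh g h * (ε * D) ^ 2) * D ^ 2 ≤
      (32 * (trueSize z g + d) * (2 * σ) ^ 2) * D ^ 2 := by linarith
  have h3 := le_of_mul_le_mul_right h2 (by positivity)
  have h4 : (confusion z zh g h : ℝ) * (ε * separation θ) ^ 2 ≤
      32 * (trueSize z g + d) * (2 * σ) ^ 2 := le_trans (by gcongr) h3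
  rw [snr, ← mul_div_assoc, div_pow, ← mul_div_assoc, div_le_iff₀ (by positivity)]
  exact h4

lemma trueSize_eq_sum_confusion (z : Fin n → Fin k) (zh : Fin n ⊕ Fin m → Fin k) (g : Fin k) :
    (trueSize z g : ℝ) = ∑ h, (confusion z zh g h : ℝ) := by
  have := card_eq_sum_card_fiberwise (f := fun i => zh (Sum.inl i))
    (s := ({i : Fin n | z i = g} : Finset (Fin n))) (t := univ) (fun _ _ => mem_univ _)
  simp_rw [filter_filter] at this
  exact_mod_cast this

lemma estSize_le_sum_confusion (z : Fin n → Fin k) (zh : Fin n ⊕ Fin m → Fin k) (g : Fin k) :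
    (estSize zh g : ℝ) ≤ ∑ h, (confusion z zh h g : ℝ) + m := by
  have h1 : estSize zh g =
      #{i : Fin n | zh (Sum.inl i) = g} + #{i : Fin m | zh (Sum.inr i) = g} := by
    simp only [estSize, card_filter, Fintype.sum_sum_type]
  have h2 : #{i : Fin m | zh (Sum.inr i) = g} ≤ m := (card_le_univ _).trans (by simp)
  have h3 := card_eq_sum_card_fiberwise (f := z)
    (s := ({i : Fin n | zh (Sum.inl i) = g} : Finset (Fin n))) (t := univ) (fun _ _ => mem_univ _)
  simp_rw [filter_filter, and_comm (a := zh _ = _)] at h3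
  have : estSize zh g ≤ ∑ h, confusion z zh h g + m := by
    rw [h1, h3]
    exact Nat.add_le_add_left h2 _
  exact_mod_cast this

/-- Nearest-center labels for good centers leave in every cluster a majority of correctly
labelled points. -/
lemma QuadraticBound.margin {σ : ℝ} (hq : QuadraticBound σ z w) (hσ : 0 < σ)
    (hzh : IsNearestLabelling (data θ z w x) θh zh) {ε δ : ℝ}
    (hε0 : 0 < ε) (hε : ε ≤ 1 / 2) (hΔ : 0 < separation θ) (hδ : 0 < δ)
    (hθh : ∀ g, ‖θh g - θ g‖ ≤ (1 / 2 - ε) * separation θ)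
    (hα : 0 < n * minFraction z)
    (hm : (m : ℝ) = n * minFraction z * (1 - δ))
    (hρ : 256 * ((n : ℝ) + d * k) ≤ (ε * snr σ θ) ^ 2 * (n * minFraction z) * δ) (g : Fin k) :
    2 * (3 / 8 * δ) * trueSize z g ≤ 2 * correctSize z zh g - estSize zh g := by
  set q := (ε * snr σ θ) ^ 2 with hq'
  have hqpos : 0 < q := by
    rw [hq', snr]
    positivity
  set A := n * minFraction z with hA
  have hAg : A ≤ trueSize z g := minFraction_mul_le z g
  have hconf : ∀ g h, g ≠ h → confusion z zh g h * q ≤ 32 * (trueSize z g + d) :=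
    fun g h hgh => hq.confusion_mul_le hσ hzh hε0.le hε hΔ hθh hgh
  have hlost : (∑ h ∈ univ.erase g, (confusion z zh g h : ℝ)) * q ≤
      32 * (k * trueSize z g + d * k) := by
    rw [sum_mul]
    calc _ ≤ ∑ h ∈ univ.erase g, 32 * ((trueSize z g : ℝ) + d) :=
          sum_le_sum fun h hh => hconf g h (ne_of_mem_erase hh).symm
      _ ≤ ∑ h : Fin k, 32 * ((trueSize z g : ℝ) + d) :=
          sum_le_sum_of_subset_of_nonneg (erase_subset _ _) fun _ _ _ => by positivity
      _ = _ := by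
          rw [sum_const, card_fin, nsmul_eq_mul]
          ring
  have hgain : (∑ h ∈ univ.erase g, (confusion z zh h g : ℝ)) * q ≤ 32 * (n + d * k) := by
    rw [sum_mul]
    calc _ ≤ ∑ h ∈ univ.erase g, 32 * ((trueSize z h : ℝ) + d) :=
          sum_le_sum fun h hh => hconf h g (ne_of_mem_erase hh)
      _ ≤ ∑ h : Fin k, 32 * ((trueSize z h : ℝ) + d) :=
          sum_le_sum_of_subset_of_nonneg (erase_subset _ _) fun _ _ _ => by positivity
      _ = _ := by
          rw [← mul_sum, sum_add_distrib, sum_trueSize, sum_const, card_fin, nsmul_eq_mul]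
          ring
  have hlost' : ∑ h ∈ univ.erase g, (confusion z zh g h : ℝ) ≤ δ / 8 * trueSize z g := by
    have hk : A * k ≤ n := card_mul_minFraction_le z
    -- The factor `A` turns `k n_g^*` into at most `n n_g^*`, because `A k ≤ n`.
    have h1 : A * (32 * (k * trueSize z g + d * k)) ≤ A * (δ / 8 * trueSize z g * q) := by
      have h2 : A * (d * k) ≤ trueSize z g * ((d : ℝ) * k) := by gcongr
      have h3 : (A * k) * trueSize z g ≤ n * trueSize z g := by gcongr
      have h4 := mul_le_mul_of_nonneg_left hρ (Nat.cast_nonneg (α := ℝ) (trueSize z g))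
      linarith
    exact le_of_mul_le_mul_right (hlost.trans (le_of_mul_le_mul_left h1 hα)) hqpos
  have hgain' : ∑ h ∈ univ.erase g, (confusion z zh h g : ℝ) ≤ δ / 8 * trueSize z g := by
    refine le_of_mul_le_mul_right (hgain.trans ?_) hqpos
    have : q * δ * A ≤ q * δ * trueSize z g := by gcongr
    linarith
  have ht := trueSize_eq_sum_confusion z zh g
  have he := estSize_le_sum_confusion z zh g
  rw [← add_sum_erase _ _ (mem_univ g)] at ht he
  have hc : (correctSize z zh g : ℝ) = confusion z zh g g := rfl
  rw [hc]
  -- The excess is at least `n_g^* - lost - gained - m`, hence at least `(1 - δ/8 - δ/8 - (1 - δ))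
  -- n_g^* = (3/4) δ n_g^*`.
  by_cases hδ1 : δ ≤ 1
  · have : A * (1 - δ) ≤ trueSize z g * (1 - δ) :=
      mul_le_mul_of_nonneg_right hAg (by linarith)
    linarith
  · have : A * (1 - δ) < 0 := mul_neg_of_pos_of_neg hα (by linarith)
    have : (0 : ℝ) ≤ m := Nat.cast_nonneg m
    linarith

/-- A median of `S` can be far from `a` only if many points of a majority `G` of `S` are. -/
lemma IsMedian.two_mul_card_sub_le {ι : Type*} [DecidableEq ι] {S G : Finset ι} {v : ι → ℝ} {c : ℝ}
    (hc : IsMedian S v c) (hG : G ⊆ S) (a : ℝ) :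
    2 * (#G : ℝ) - #S ≤ 2 * #{i ∈ G | |c - a| ≤ |v i - a|} := by
  -- `p` selects the side of `c` away from `a`: it holds at least half of `S`, of which at most `#S
  -- - #G` points lie outside `G`.
  have key : ∀ p : ι → Prop, ∀ _ : DecidablePred p, #S ≤ 2 * #{i ∈ S | p i} →
      (∀ i, p i → |c - a| ≤ |v i - a|) →
      2 * (#G : ℝ) - #S ≤ 2 * #{i ∈ G | |c - a| ≤ |v i - a|} := by
    intro p _ h1 h2
    have hsub : ({i ∈ S | p i} : Finset ι) ⊆ {i ∈ G | |c - a| ≤ |v i - a|} ∪ (S \ G) := by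
      intro i hi
      have := h2 i
      simp only [mem_filter, mem_union, mem_sdiff] at hi ⊢
      tauto
    have h3 := (card_le_card hsub).trans (card_union_le _ _)
    rw [card_sdiff_of_subset hG] at h3
    have h4 := card_le_card hG
    have : 2 * #G ≤ 2 * #{i ∈ G | |c - a| ≤ |v i - a|} + #S := by omega
    have : (2 * #G : ℝ) ≤ 2 * #{i ∈ G | |c - a| ≤ |v i - a|} + #S := by exact_mod_cast this
    linarith
  rcases le_total a c with h | h
  · refine key _ _ hc.2 fun i hi => ?_
    rw [abs_of_nonneg (by linarith), abs_of_nonneg (by linarith)]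
    linarith
  · refine key _ _ hc.1 fun i hi => ?_
    rw [abs_of_nonpos (by linarith), abs_of_nonpos (by linarith)]
    linarith

/-- Coordinatewise medians of clusters with a majority of correctly labelled points are close to
the true centers. -/
lemma IsMedianCenters.norm_sub_sq_mul_le {σ γ : ℝ} (hθ : IsMedianCenters (data θ z w x) zh θh)
    (hw : ∀ j, ∑ i, w i j ^ 2 ≤ 5 * n * σ ^ 2)
    (hα : 0 < n * minFraction z) (hγ : 0 ≤ γ) {g : Fin k}
    (hmargin : 2 * γ * trueSize z g ≤ 2 * correctSize z zh g - estSize zh g) :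
    ‖θh g - θ g‖ ^ 2 * (γ * minFraction z) ≤ 5 * d * σ ^ 2 := by
  have hn : (0 : ℝ) < n := by
    rcases Nat.eq_zero_or_pos n with rfl | h
    · simp at hα
    · exact_mod_cast h
  have hcoord : ∀ j, (θh g j - θ g j) ^ 2 * (γ * minFraction z) ≤ 5 * σ ^ 2 := by
    intro j
    set G₀ : Finset (Fin n) := {i : Fin n | z i = g ∧ zh (Sum.inl i) = g} with hG₀
    have hsub : G₀.map Function.Embedding.inl ⊆
        ({i : Fin n ⊕ Fin m | zh i = g} : Finset (Fin n ⊕ Fin m)) := by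
      intro i hi
      simp only [mem_map, hG₀, mem_filter, mem_univ, true_and] at hi ⊢
      obtain ⟨i, ⟨-, hi⟩, rfl⟩ := hi
      exact hi
    have h1 := (hθ g j).two_mul_card_sub_le hsub (θ g j)
    rw [filter_map, card_map, card_map] at h1
    have h2 : 2 * (correctSize z zh g : ℝ) - estSize zh g ≤ 2 * #{i ∈ G₀ |
        |θh g j - θ g j| ≤ |data θ z w x (Sum.inl i) j - θ g j|} := h1
    have h3 : (#{i ∈ G₀ | |θh g j - θ g j| ≤ |data θ z w x (Sum.inl i) j - θ g j|} : ℝ) *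
        (θh g j - θ g j) ^ 2 ≤ 5 * n * σ ^ 2 := by
      refine le_trans ?_ (hw j)
      rw [← nsmul_eq_mul, ← sum_const]
      refine le_trans (sum_le_sum fun i hi => ?_)
        (sum_le_sum_of_subset_of_nonneg (subset_univ _) fun i _ _ => sq_nonneg _)
      simp only [hG₀, mem_filter, mem_univ, true_and, data, Sum.elim_inl] at hi
      obtain ⟨⟨hz, -⟩, hi⟩ := hi
      rw [hz] at hi
      simpa using sq_le_sq.2 hi
    have h4 : (n * minFraction z) * γ * (θh g j - θ g j) ^ 2 ≤ 5 * n * σ ^ 2 := by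
      refine le_trans ?_ h3
      gcongr
      have := mul_le_mul_of_nonneg_right (minFraction_mul_le z g) hγ
      linarith
    refine le_of_mul_le_mul_left ?_ hn
    linarith
  rw [EuclideanSpace.real_norm_sq_eq, sum_mul]
  calc _ ≤ ∑ _j : Fin d, 5 * σ ^ 2 := sum_le_sum fun j _ => hcoord j
    _ = _ := by
      rw [sum_const, card_fin, nsmul_eq_mul]
      ring

/-- The noise vector `v` of a point of component `g` is atypically large. -/
def IsLargeNoise (σ ν : ℝ) (θ : Fin k → Pt d) (g : Fin k) (v : Pt d) : Prop :=
  (∃ h ≠ g, ‖θ h - θ g‖ ^ 2 * (1 / 2 - 10 / ν) ≤ inner ℝ (θ h - θ g) v) ∨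
    4 * σ * snr σ θ ≤ ‖v‖

/-- If `‖w i‖ ≤ 2Δ`, passing from estimated to true centers changes the inner product by at most
`(4Δ/ν)(2Δ) ≤ (8/ν) D²`, where `D` is the distance between the two true centers. This lowers the
threshold `1/2 - 2/ν` to `1/2 - 10/ν`. -/
lemma IsNearestLabelling.isLargeNoise {σ ν : ℝ} (hσ : 0 < σ)
    (hzh : IsNearestLabelling (data θ z w x) θh zh) (hν : 4 ≤ ν) (hΔ : 0 < separation θ)
    (hθh : ∀ g, ‖θh g - θ g‖ ≤ 2 / ν * separation θ) {i : Fin n} (hi : zh (Sum.inl i) ≠ z i) :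
    IsLargeNoise σ ν θ (z i) (w i) := by
  have hν0 : 0 < ν := by linarith
  rw [IsLargeNoise, or_iff_not_imp_right, not_le]
  intro hw
  refine ⟨_, hi, ?_⟩
  have h1 := hzh.le_inner (by positivity)
    (by rw [div_le_iff₀ hν0]; linarith) hΔ hθh hi
  have hD := separation_le θ hi
  have hg := hθh (z i)
  have hh := hθh (zh (Sum.inl i))
  set a := θ (z i)
  set b := θ (zh (Sum.inl i))
  set a' := θh (z i)
  set b' := θh (zh (Sum.inl i))
  set Δ := separation θ
  have hw' : ‖w i‖ ≤ 2 * Δ := by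
    have : 4 * σ * snr σ θ = 2 * Δ := by
      rw [snr]
      field_simp
      ring
    linarith
  have h2 : inner ℝ (b' - a') (w i) =
      inner ℝ (b - a) (w i) + inner ℝ ((b' - b) - (a' - a)) (w i) := by
    rw [← inner_add_left]
    congr 1
    abel
  have h3 : inner ℝ ((b' - b) - (a' - a)) (w i) ≤ (2 / ν * Δ + 2 / ν * Δ) * (2 * Δ) := by
    refine (real_inner_le_norm _ _).trans ?_
    gcongr
    exact (norm_sub_le _ _).trans (add_le_add hh hg)
  have h4 : 8 / ν * Δ ^ 2 ≤ 8 / ν * ‖b - a‖ ^ 2 := by gcongr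
  have h5 : (2 / ν * Δ + 2 / ν * Δ) * (2 * Δ) = 8 / ν * Δ ^ 2 := by ring
  have h6 : ‖b - a‖ ^ 2 * (1 / 2 - 10 / ν) =
      ‖b - a‖ ^ 2 * (1 / 2 - 2 / ν) - 8 / ν * ‖b - a‖ ^ 2 := by ring
  linarith

end Labelling

/-! ### The three exceptional events -/

section Probability

variable {Ω : Type*} [MeasurableSpace Ω] {μ : Measure Ω} [IsProbabilityMeasure μ] {d k n : ℕ}
  {σ : ℝ} {θ : Fin k → Pt d} {z : Fin n → Fin k} {w : Fin n → Ω → Pt d}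

lemma five_pow_le_exp (d : ℕ) : (5 : ℝ) ^ d ≤ Real.exp (2 * d) := by
  rw [mul_comm, Real.exp_nat_mul]
  gcongr
  have := Real.quadratic_le_exp_of_nonneg (x := 2) (by norm_num)
  linarith

/-- The quadratic forms of the noise are bounded outside an event of small probability. -/
lemma exists_quadraticBound (hσ : 0 < σ) (hm : ∀ i, Measurable (w i)) (hind : iIndepFun w μ)
    (hw : ∀ i, IsSubGaussian σ (w i) μ) (hn : 0 < n)
    (hlog : ∀ g, 4 * Real.log n ≤ trueSize z g) :
    ∃ B : Set Ω, MeasurableSet B ∧ μ.real B ≤ k * (n : ℝ) ^ (-4 : ℤ) ∧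
      ∀ ω ∉ B, QuadraticBound σ z fun i => w i ω := by
  obtain ⟨s, hcard, hs1, hs⟩ := exists_net d
  refine ⟨⋃ g ∈ (univ : Finset (Fin k)), ⋃ u ∈ s, {ω | 8 * (trueSize z g + d) * σ ^ 2 ≤
    ∑ i with z i = g, inner ℝ u (w i ω) ^ 2}, ?_, ?_, ?_⟩
  · refine Finset.measurableSet_biUnion _ fun g _ => Finset.measurableSet_biUnion _ fun u _ => ?_
    exact measurableSet_le measurable_const
      (Finset.measurable_sum _ fun i _ => by have := hm i; fun_prop)
  · refine (measureReal_biUnion_finset_le _ _).trans ?_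
    have hg : ∀ g ∈ (univ : Finset (Fin k)), μ.real (⋃ u ∈ s, {ω |
        8 * (trueSize z g + d) * σ ^ 2 ≤ ∑ i with z i = g, inner ℝ u (w i ω) ^ 2}) ≤
        (n : ℝ) ^ (-4 : ℤ) := by
      intro g _
      calc _ ≤ ∑ u ∈ s, Real.exp (trueSize z g / 2 - 8 * (trueSize z g + d) / 4) :=
            (measureReal_biUnion_finset_le _ _).trans (sum_le_sum fun u hu =>
              measureReal_sum_inner_sq_ge_le hσ hm hind hw _ (hs1 u hu) _)
        _ ≤ Real.exp (2 * d) * Real.exp (trueSize z g / 2 - 8 * (trueSize z g + d) / 4) := by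
            rw [sum_const, nsmul_eq_mul]
            gcongr
            refine le_trans ?_ (five_pow_le_exp d)
            exact_mod_cast hcard
        -- The total exponent is `2d + n_g^*/2 - 2(n_g^* + d) = -(3/2) n_g^*`.
        _ ≤ Real.exp (-(4 * Real.log n)) := by
            rw [← Real.exp_add, Real.exp_le_exp]
            have := hlog g
            have h0 : (0 : ℝ) ≤ trueSize z g := Nat.cast_nonneg _
            linarith
        _ = _ := by
            rw [Real.exp_neg, zpow_neg]
            congr 1
            have : (4 : ℝ) * Real.log n = Real.log ((n : ℝ) ^ (4 : ℕ)) := by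
              rw [Real.log_pow]
              norm_num
            rw [this, Real.exp_log (by positivity)]
            rfl
    refine (sum_le_sum hg).trans ?_
    rw [sum_const, card_fin, nsmul_eq_mul]
  · intro ω hω g u
    refine (sum_inner_sq_le_of_net hs _ _ (M := 8 * (trueSize z g + d) * σ ^ 2)
      (fun u hu => ?_) u).trans (le_of_eq (by ring))
    simp only [Set.mem_iUnion, not_exists, Set.mem_ofPred_eq, not_le] at hω
    exact (hω g (mem_univ g) u hu).le

/-- The squared coordinates of the noise have bounded average outside an event of small
probability. -/
lemma exists_coordBound (hσ : 0 < σ) (hm : ∀ i, Measurable (w i)) (hind : iIndepFun w μ)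
    (hw : ∀ i, IsSubGaussian σ (w i) μ) :
    ∃ B : Set Ω, MeasurableSet B ∧ μ.real B ≤ d * Real.exp (-0.3 * n) ∧
      ∀ ω ∉ B, ∀ j, ∑ i, w i ω j ^ 2 ≤ 5 * n * σ ^ 2 := by
  refine ⟨⋃ j ∈ (univ : Finset (Fin d)), {ω | 5 * n * σ ^ 2 ≤
    ∑ i, inner ℝ (EuclideanSpace.single j (1 : ℝ)) (w i ω) ^ 2}, ?_, ?_, ?_⟩
  · refine Finset.measurableSet_biUnion _ fun j _ => ?_
    exact measurableSet_le measurable_const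
      (Finset.measurable_sum _ fun i _ => by have := hm i; fun_prop)
  · refine (measureReal_biUnion_finset_le _ _).trans ?_
    calc _ ≤ ∑ j : Fin d, Real.exp (-0.3 * n) := by
          refine sum_le_sum fun j _ => (measureReal_sum_inner_sq_ge_le hσ hm hind hw _
            (by simp) _).trans (Real.exp_le_exp.2 ?_)
          rw [card_fin]
          have h0 : (0 : ℝ) ≤ n := Nat.cast_nonneg _
          linarith
      _ = _ := by rw [sum_const, card_fin, nsmul_eq_mul]
  · intro ω hω j
    simp only [Set.mem_iUnion, not_exists, Set.mem_ofPred_eq, not_le] at hω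
    simpa [EuclideanSpace.inner_single_left] using (hω j (mem_univ j)).le

lemma measurableSet_isLargeNoise {ν : ℝ} {v : Ω → Pt d} (hv : Measurable v) (g : Fin k) :
    MeasurableSet {ω | IsLargeNoise σ ν θ g (v ω)} := by
  unfold IsLargeNoise
  refine MeasurableSet.union ?_ (measurableSet_le measurable_const hv.norm)
  have h1 : {ω | ∃ h ≠ g, ‖θ h - θ g‖ ^ 2 * (1 / 2 - 10 / ν) ≤ inner ℝ (θ h - θ g) (v ω)} =
      ⋃ h ∈ univ.erase g,
        {ω | ‖θ h - θ g‖ ^ 2 * (1 / 2 - 10 / ν) ≤ inner ℝ (θ h - θ g) (v ω)} := by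
    ext ω
    simp
  change MeasurableSet {ω | ∃ h ≠ g, _}
  rw [h1]
  exact Finset.measurableSet_biUnion _ fun h _ => measurableSet_le measurable_const (by fun_prop)

/-- A union bound over the `k - 1` wrong centers and the norm event. The latter fills the missing
`k`-th term: over the net it costs `exp (2d - 2S²) ≤ exp (-S²)`, where `S = snr σ θ`. -/
lemma measureReal_isLargeNoise_le {ν : ℝ} {v : Ω → Pt d} (hv : IsSubGaussian σ v μ) (hσ : 0 < σ)
    (hΔ : 0 < separation θ) (hν : 20 ≤ ν) (hd : 2 * d ≤ snr σ θ ^ 2) (g : Fin k) :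
    μ.real {ω | IsLargeNoise σ ν θ g (v ω)} ≤
      k * Real.exp (-(1 / 2) * (1 - 40 / ν) * snr σ θ ^ 2) := by
  obtain ⟨s, hcard, hs1, hs⟩ := exists_net d
  set S := snr σ θ with hS
  have hν0 : 0 < ν := by linarith
  have hS0 : 0 < S := by
    rw [hS, snr]
    positivity
  have hsub : {ω | IsLargeNoise σ ν θ g (v ω)} ⊆
      (⋃ h ∈ univ.erase g, {ω | ‖θ h - θ g‖ ^ 2 * (1 / 2 - 10 / ν) ≤ inner ℝ (θ h - θ g) (v ω)}) ∪
        ⋃ u ∈ s, {ω | 2 * σ * S ≤ inner ℝ u (v ω)} := by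
    rintro ω (⟨h, hh, hω⟩ | hω)
    · refine Or.inl ?_
      simp only [Set.mem_iUnion]
      exact ⟨h, mem_erase.2 ⟨hh, mem_univ _⟩, hω⟩
    · refine Or.inr ?_
      obtain ⟨u, hu, h⟩ := norm_le_two_mul_of_net hs (v ω)
      simp only [Set.mem_iUnion]
      refine ⟨u, hu, ?_⟩
      rw [Set.mem_ofPred_eq]
      linarith
  have h1 : ∀ h ∈ univ.erase g,
      μ.real {ω | ‖θ h - θ g‖ ^ 2 * (1 / 2 - 10 / ν) ≤ inner ℝ (θ h - θ g) (v ω)} ≤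
        Real.exp (-(1 / 2) * (1 - 40 / ν) * S ^ 2) := by
    intro h hh
    have hD : separation θ ≤ ‖θ h - θ g‖ := separation_le θ (ne_of_mem_erase hh)
    set D := ‖θ h - θ g‖
    have hDpos : 0 < D := hΔ.trans_le hD
    have h10 : 10 / ν ≤ 1 / 2 := by
      rw [div_le_iff₀ hν0]
      linarith
    refine (hv.measureReal_inner_ge_le hσ hDpos le_rfl
      (mul_nonneg (sq_nonneg _) (by linarith))).trans (Real.exp_le_exp.2 ?_)
    have e1 : (D ^ 2 * (1 / 2 - 10 / ν)) ^ 2 / (2 * σ ^ 2 * D ^ 2) =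
        (D / (2 * σ)) ^ 2 * (2 * (1 / 2 - 10 / ν) ^ 2) := by
      field_simp
    rw [e1]
    have e2 : S ^ 2 ≤ (D / (2 * σ)) ^ 2 := by
      rw [hS, snr]
      gcongr
    have e3 : S ^ 2 * (2 * (1 / 2 - 10 / ν) ^ 2) ≤
        (D / (2 * σ)) ^ 2 * (2 * (1 / 2 - 10 / ν) ^ 2) := by gcongr
    have e4 : 2 * (1 / 2 - 10 / ν) ^ 2 = 1 / 2 * (1 - 40 / ν) + 200 * (1 / ν) ^ 2 := by ring
    have e5 : 0 ≤ S ^ 2 * (200 * (1 / ν) ^ 2) := by positivity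
    rw [e4] at e3 ⊢
    linarith
  have h2 : μ.real (⋃ u ∈ s, {ω | 2 * σ * S ≤ inner ℝ u (v ω)}) ≤
      Real.exp (-(1 / 2) * (1 - 40 / ν) * S ^ 2) := by
    calc _ ≤ ∑ u ∈ s, Real.exp (-(2 * S ^ 2)) := by
          refine (measureReal_biUnion_finset_le _ _).trans (sum_le_sum fun u hu => ?_)
          refine (hv.measureReal_inner_ge_le hσ one_pos (hs1 u hu) (by positivity)).trans_eq ?_
          congr 2
          field_simp
      _ ≤ Real.exp (2 * d) * Real.exp (-(2 * S ^ 2)) := by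
          rw [sum_const, nsmul_eq_mul]
          gcongr
          refine le_trans ?_ (five_pow_le_exp d)
          exact_mod_cast hcard
      _ ≤ _ := by
          rw [← Real.exp_add, Real.exp_le_exp]
          have : 0 ≤ 40 / ν * S ^ 2 := by positivity
          nlinarith
  calc _ ≤ _ := measureReal_mono hsub
    _ ≤ _ := measureReal_union_le _ _
    _ ≤ ∑ h ∈ univ.erase g, Real.exp (-(1 / 2) * (1 - 40 / ν) * S ^ 2) +
        Real.exp (-(1 / 2) * (1 - 40 / ν) * S ^ 2) :=
      add_le_add ((measureReal_biUnion_finset_le _ _).trans (sum_le_sum h1)) h2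
    _ = _ := by
      rw [sum_erase_add _ _ (mem_univ g), sum_const, card_fin, nsmul_eq_mul]

open Classical in
/-- Few noise vectors are large, outside an event of small probability. -/
lemma exists_card_isLargeNoise_le {ν : ℝ} (hσ : 0 < σ) (hm : ∀ i, Measurable (w i))
    (hw : ∀ i, IsSubGaussian σ (w i) μ) (hΔ : 0 < separation θ) (hν : 20 ≤ ν)
    (hd : 2 * d ≤ snr σ θ ^ 2) (hn : 0 < n) (hk : 0 < k) :
    ∃ B : Set Ω, MeasurableSet B ∧ μ.real B ≤ Real.exp (-(snr σ θ / 4)) ∧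
      ∀ ω ∉ B, (#{i : Fin n | IsLargeNoise σ ν θ (z i) (w i ω)} : ℝ) ≤ n *
        (Real.exp (snr σ θ / 4) * (k * Real.exp (-(1 / 2) * (1 - 40 / ν) * snr σ θ ^ 2))) := by
  set p := k * Real.exp (-(1 / 2) * (1 - 40 / ν) * snr σ θ ^ 2) with hp
  have hp0 : 0 < p := by positivity
  set L : Fin n → Set Ω := fun i => {ω | IsLargeNoise σ ν θ (z i) (w i ω)} with hL
  have hLm : ∀ i, MeasurableSet (L i) := fun i => measurableSet_isLargeNoise (hm i) _
  set f : Ω → ℝ := fun ω => ∑ i, (L i).indicator 1 ω with hf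
  have hfm : Measurable f := Finset.measurable_sum _ fun i _ => measurable_one.indicator (hLm i)
  have hint : ∀ i, Integrable ((L i).indicator (1 : Ω → ℝ)) μ := fun i =>
    (integrable_const (1 : ℝ)).indicator (hLm i)
  have hfi : Integrable f μ := integrable_finsetSum _ fun i _ => hint i
  have hfE : ∫ ω, f ω ∂μ ≤ n * p := by
    rw [integral_finsetSum _ fun i _ => hint i]
    calc _ = ∑ i, μ.real (L i) := sum_congr rfl fun i _ => integral_indicator_one (hLm i)
      _ ≤ ∑ _i : Fin n, p := sum_le_sum fun i _ =>
          measureReal_isLargeNoise_le (hw i) hσ hΔ hν hd _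
      _ = _ := by rw [sum_const, card_fin, nsmul_eq_mul]
  have hfc : ∀ ω, f ω = #{i : Fin n | IsLargeNoise σ ν θ (z i) (w i ω)} := fun ω => by
    rw [card_filter, Nat.cast_sum]
    refine sum_congr rfl fun i _ => ?_
    simp [Set.indicator_apply, hL]
  refine ⟨{ω | n * (Real.exp (snr σ θ / 4) * p) ≤ f ω}, measurableSet_le measurable_const hfm,
    ?_, ?_⟩
  -- Markov's inequality: exceeding `exp (S / 4)` times the bound on the mean has probability at
  -- most `exp (-S / 4)`.
  · have h := (mul_meas_ge_le_integral_of_nonneg (μ := μ) (f := f)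
      (ae_of_all _ fun ω => sum_nonneg fun i _ => Set.indicator_nonneg (fun _ _ => zero_le_one) _)
      hfi (n * (Real.exp (snr σ θ / 4) * p))).trans hfE
    have h' : (n * p) * (Real.exp (snr σ θ / 4) *
        μ.real {ω | n * (Real.exp (snr σ θ / 4) * p) ≤ f ω}) ≤ (n * p) * 1 := by linarith
    have h2 := le_of_mul_le_mul_left h' (by positivity)
    rw [Real.exp_neg, ← one_div, le_div_iff₀' (Real.exp_pos _)]
    exact h2
  · intro ω hω
    rw [Set.mem_ofPred_eq, not_le, hfc] at hω
    exact hω.le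

end Probability

/-! ### The iterations of the algorithm -/

section Run

variable {d k n m : ℕ} {σ δ : ℝ} {θ : Fin k → Pt d} {z : Fin n → Fin k} {w : Fin n → Pt d}
  {x : Fin m → Pt d}

/-- Since `n_g ≤ n_gg / (1/2 + γ)`, the excess is at least `2γ n_gg / (1/2 + γ) ≥ 2γ n_g^*`. The
convention `0/0 = 0` rules out empty clusters. -/
lemma margin_of_le_correctProportion {zh : Fin n ⊕ Fin m → Fin k} {γ : ℝ} (hγ : 0 ≤ γ)
    (h : 1 / 2 + γ ≤ correctProportion z zh) (g : Fin k) :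
    2 * γ * trueSize z g ≤ 2 * correctSize z zh g - estSize zh g := by
  have h1 := h.trans (ciInf_le (Set.finite_range fun g : Fin k =>
    min ((correctSize z zh g : ℝ) / trueSize z g)
      ((correctSize z zh g : ℝ) / estSize zh g)).bddBelow g)
  obtain ⟨ht, he⟩ := le_min_iff.1 h1
  have hT : (0 : ℝ) < trueSize z g := by
    rcases (Nat.cast_nonneg (α := ℝ) (trueSize z g)).eq_or_lt with h0 | h0
    · rw [← h0, div_zero] at ht
      linarith
    · exact h0
  have hE : (0 : ℝ) < estSize zh g := by
    rcases (Nat.cast_nonneg (α := ℝ) (estSize zh g)).eq_or_lt with h0 | h0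
    · rw [← h0, div_zero] at he
      linarith
    · exact h0
  rw [le_div_iff₀ hT] at ht
  rw [le_div_iff₀ hE] at he
  have h2 : γ * ((1 / 2 + γ) * trueSize z g) ≤ γ * correctSize z zh g := by gcongr
  have h3 : (1 / 2 + γ) * (2 * γ * trueSize z g) ≤
      (1 / 2 + γ) * (2 * correctSize z zh g - estSize zh g) := by linarith
  exact le_of_mul_le_mul_left h3 (by positivity)

/-- One step of the algorithm brings good centers within `2 / ν` of the true ones. -/
lemma QuadraticBound.norm_sub_le_of_step {θh θh' : Fin k → Pt d} {zh : Fin n ⊕ Fin m → Fin k}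
    {ν τ ε : ℝ} (hq : QuadraticBound σ z w) (hc : ∀ j, ∑ i, w i j ^ 2 ≤ 5 * n * σ ^ 2)
    (hσ : 0 < σ) (hΔ : 0 < separation θ) (hδ : 0 < δ) (hα : 0 < n * minFraction z) (hd : 0 < d)
    (hm : (m : ℝ) = n * minFraction z * (1 - δ)) (hν0 : 0 < ν)
    (hν : ν ^ 2 * d = δ * snr σ θ ^ 2 * minFraction z)
    (hτ : τ ^ 2 * (n + d * k) = δ * snr σ θ ^ 2 * minFraction z * n)
    (hε0 : 0 < ε) (hε : ε ≤ 1 / 2) (hετ : 256 ≤ (ε * τ) ^ 2)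
    (hθh : ∀ g, ‖θh g - θ g‖ ≤ (1 / 2 - ε) * separation θ)
    (hzh : IsNearestLabelling (data θ z w x) θh zh)
    (hθh' : IsMedianCenters (data θ z w x) zh θh') (g : Fin k) :
    ‖θh' g - θ g‖ ≤ 2 / ν * separation θ := by
  have hρ : 256 * ((n : ℝ) + d * k) ≤ (ε * snr σ θ) ^ 2 * (n * minFraction z) * δ := by
    calc 256 * ((n : ℝ) + d * k) ≤ (ε * τ) ^ 2 * (n + d * k) := by gcongr
      _ = ε ^ 2 * (τ ^ 2 * (n + d * k)) := by ring
      _ = _ := by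
        rw [hτ]
        ring
  have h1 := hθh'.norm_sub_sq_mul_le hc hα (by positivity)
    (hq.margin hσ hzh hε0 hε hΔ hδ hθh hα hm hρ g)
  set e := ‖θh' g - θ g‖
  set S := snr σ θ with hS
  have hS0 : 0 < S := by
    rw [hS, snr]
    positivity
  have hΔS : separation θ = 2 * σ * S := by
    rw [hS, snr]
    field_simp
  have hd' : (0 : ℝ) < d := by exact_mod_cast hd
  have h2 : d * (e ^ 2 * (3 / 8) * ν ^ 2) ≤ d * (5 * σ ^ 2 * S ^ 2) := by
    calc d * (e ^ 2 * (3 / 8) * ν ^ 2) = e ^ 2 * (3 / 8) * (ν ^ 2 * d) := by ring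
      _ = (e ^ 2 * (3 / 8 * δ * minFraction z)) * S ^ 2 := by
        rw [hν]
        ring
      _ ≤ (5 * d * σ ^ 2) * S ^ 2 := by gcongr
      _ = _ := by ring
  have h3 := le_of_mul_le_mul_left h2 hd'
  rw [hΔS, div_mul_eq_mul_div, le_div_iff₀ hν0]
  -- `h3` gives `e² ν² ≤ (40/3) σ² S²`, which is below `(4σS)² = (2Δ)²`.
  refine abs_le_of_sq_le_sq' ?_ (by positivity) |>.2
  have : 0 ≤ σ ^ 2 * S ^ 2 := by positivity
  linarith

/-- All centers produced by the algorithm are within `2 / ν` of the true ones. -/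
lemma QuadraticBound.norm_sub_le_of_run {zh : ℕ → Fin n ⊕ Fin m → Fin k} {θh : ℕ → Fin k → Pt d}
    {ν τ : ℝ} (hq : QuadraticBound σ z w) (hc : ∀ j, ∑ i, w i j ^ 2 ≤ 5 * n * σ ^ 2)
    (hσ : 0 < σ) (hΔ : 0 < separation θ) (hδ : 0 < δ) (hα : 0 < n * minFraction z) (hd : 0 < d)
    (hm : (m : ℝ) = n * minFraction z * (1 - δ))
    (hν : ν ^ 2 * d = δ * snr σ θ ^ 2 * minFraction z)
    (hτ : τ ^ 2 * (n + d * k) = δ * snr σ θ ^ 2 * minFraction z * n)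
    (hν8 : 8 ≤ ν) (hτ256 : 256 ≤ τ) (hrun : IsHybridRun (data θ z w x) zh θh)
    (hinit : (∀ g, ‖θh 0 g - θ g‖ ≤ 1 / 4 * separation θ) ∨
      ∀ g, ‖θh 0 g - θ g‖ ≤ (1 / 2 - 1 / √τ) * separation θ) (s : ℕ) (g : Fin k) :
    ‖θh (s + 1) g - θ g‖ ≤ 2 / ν * separation θ := by
  have hτ0 : 0 < τ := by linarith
  have step : ∀ (s : ℕ) (ε : ℝ), 0 < ε → ε ≤ 1 / 2 → 256 ≤ (ε * τ) ^ 2 →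
      (∀ g, ‖θh s g - θ g‖ ≤ (1 / 2 - ε) * separation θ) →
      ∀ g, ‖θh (s + 1) g - θ g‖ ≤ 2 / ν * separation θ :=
    fun s ε hε0 hε hετ hθh => hq.norm_sub_le_of_step hc hσ hΔ hδ hα hd hm (by linarith) hν hτ
      hε0 hε hετ hθh (hrun.label s) (hrun.center s)
  have quarter : ∀ s : ℕ, (∀ g, ‖θh s g - θ g‖ ≤ 1 / 4 * separation θ) →
      ∀ g, ‖θh (s + 1) g - θ g‖ ≤ 2 / ν * separation θ := by
    intro s hs
    refine step s (1 / 4) (by norm_num) (by norm_num) (by nlinarith) fun g => (hs g).trans_eq ?_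
    norm_num
  induction s generalizing g with
  | zero =>
    rcases hinit with h | h
    · exact quarter 0 h g
    -- For `ε = 1/√τ` the requirement `256 ≤ (ε τ)²` reads `256 ≤ τ`.
    · refine step 0 (1 / √τ) (by positivity) ?_ ?_ h g
      · gcongr
        exact Real.le_sqrt_of_sq_le (by linarith)
      · rw [mul_pow, div_pow, Real.sq_sqrt hτ0.le]
        field_simp
        linarith
  | succ s ih =>
    refine quarter (s + 1) (fun g => (ih g).trans ?_) g
    have : 2 / ν ≤ 1 / 4 := by
      rw [div_le_iff₀ (by linarith)]
      linarith
    gcongr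

/-- Reduces initialization by labels to initialization by centers: the constant `20` makes the
median bound `e² ≤ σ² S² / 4 = (Δ/4)²`. -/
lemma IsMedianCenters.norm_sub_le_quarter {zh : Fin n ⊕ Fin m → Fin k} {θh : Fin k → Pt d}
    (hc : ∀ j, ∑ i, w i j ^ 2 ≤ 5 * n * σ ^ 2) (hσ : 0 < σ) (hΔ : 0 < separation θ)
    (hα : 0 < minFraction z) (hn : 0 < n) (hd : 0 < d)
    (hθh : IsMedianCenters (data θ z w x) zh θh)
    (hH : 1 / 2 + 20 / (snr σ θ * √(minFraction z / d)) ^ 2 ≤ correctProportion z zh)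
    (g : Fin k) : ‖θh g - θ g‖ ≤ 1 / 4 * separation θ := by
  have h1 := hθh.norm_sub_sq_mul_le hc (by positivity) (by positivity)
    (margin_of_le_correctProportion (by positivity) hH g)
  set e := ‖θh g - θ g‖
  rw [mul_pow, Real.sq_sqrt (by positivity)] at h1
  set S := snr σ θ with hS
  have hS0 : 0 < S := by
    rw [hS, snr]
    positivity
  have hΔS : separation θ = 2 * σ * S := by
    rw [hS, snr]
    field_simp
  have hd' : (0 : ℝ) < d := by exact_mod_cast hd
  have e1 : e ^ 2 * (20 / (S ^ 2 * (minFraction z / d)) * minFraction z) =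
      d * (20 * e ^ 2 / S ^ 2) := by
    field_simp
  rw [e1, show 5 * (d : ℝ) * σ ^ 2 = d * (5 * σ ^ 2) by ring] at h1
  have h2 := le_of_mul_le_mul_left h1 hd'
  rw [div_le_iff₀ (by positivity)] at h2
  rw [hΔS]
  refine abs_le_of_sq_le_sq' ?_ (by positivity) |>.2
  linarith

open Classical in
lemma mislabelRate_le_of_card_isLargeNoise_le {zh : Fin n ⊕ Fin m → Fin k} {θh : Fin k → Pt d}
    {ν r : ℝ} (hσ : 0 < σ) (hn : 0 < n) (hzh : IsNearestLabelling (data θ z w x) θh zh)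
    (hν : 4 ≤ ν) (hΔ : 0 < separation θ) (hθh : ∀ g, ‖θh g - θ g‖ ≤ 2 / ν * separation θ)
    (hcard : (#{i : Fin n | IsLargeNoise σ ν θ (z i) (w i)} : ℝ) ≤ n * r) :
    mislabelRate z zh ≤ r := by
  rw [mislabelRate, div_le_iff₀' (by positivity)]
  refine le_trans ?_ hcard
  gcongr with i
  exact fun hi => hzh.isLargeNoise hσ hν hΔ hθh hi

end Run

/-! ### Numerical bounds and conclusion -/

/-- The factors `k ≤ exp S` and `exp (S / 4)` are absorbed because `S ≤ S²/ν ≤ S²/√ν`: `5/4 + 20 ≤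
22 = 44/2`. -/
lemma exp_mul_mul_exp_le {S ν k : ℝ} (hν : 2 ≤ ν) (hνS : ν ≤ S) (hk : ν ^ 2 * k ≤ S ^ 2)
    (hk0 : 0 ≤ k) :
    Real.exp (S / 4) * (k * Real.exp (-(1 / 2) * (1 - 40 / ν) * S ^ 2)) ≤
      Real.exp (-(1 / 2) * (1 - 44 / √ν) * S ^ 2) := by
  have hν0 : 0 < ν := by linarith
  have hkS : k ≤ Real.exp S := by
    have h1 := Real.quadratic_le_exp_of_nonneg (x := S) (by linarith)
    have h2 : 2 * k ≤ ν ^ 2 * k := by gcongr; nlinarith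
    linarith
  have hs : √ν ≤ ν := Real.sqrt_le_left hν0.le |>.2 (by nlinarith)
  have hs0 : 0 < √ν := by positivity
  have h1 : S ^ 2 / ν ≤ S ^ 2 / √ν := by gcongr
  have h2 : S ≤ S ^ 2 / ν := by
    rw [le_div_iff₀ hν0]
    nlinarith
  calc _ ≤ Real.exp (S / 4) *
        (Real.exp S * Real.exp (-(1 / 2) * (1 - 40 / ν) * S ^ 2)) := by gcongr
    _ = Real.exp (S / 4 + S - 1 / 2 * S ^ 2 + 20 * (S ^ 2 / ν)) := by
        rw [← Real.exp_add, ← Real.exp_add]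
        congr 1
        ring
    _ ≤ Real.exp (-(1 / 2) * S ^ 2 + 22 * (S ^ 2 / √ν)) := by
        rw [Real.exp_le_exp]
        linarith
    _ = _ := by
        congr 1
        ring

/-- Relations between the separation parameters. -/
lemma parameter_bounds {δ S α ν τ d k n : ℝ} (hδ1 : δ ≤ 1) (hS : 0 < S) (hα : 0 < α)
    (hαk : α * k ≤ 1) (hk : 2 ≤ k) (hkn : k ≤ n) (hd : 1 ≤ d) (hν : ν ^ 2 * d = δ * S ^ 2 * α)
    (hτ : τ ^ 2 * (n + d * k) = δ * S ^ 2 * α * n) (hτ0 : 0 ≤ τ) (hC : 512 < ν) :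
    256 ≤ τ ∧ ν ≤ S ∧ ν ^ 2 * k ≤ S ^ 2 ∧ 2 * d ≤ S ^ 2 := by
  have hτν : ν ^ 2 ≤ 2 * τ ^ 2 := by
    -- Uses `k ≤ n` and `1 ≤ d`; hence `τ ≥ ν/√2`, which exceeds `256` when `ν > 512`.
    have h1 : n + d * k ≤ n * (2 * d) := by nlinarith
    have h2 : τ ^ 2 * (n + d * k) ≤ τ ^ 2 * (n * (2 * d)) := by gcongr
    have h3 : (n * d) * ν ^ 2 ≤ (n * d) * (2 * τ ^ 2) := by
      have : (n * d) * ν ^ 2 = τ ^ 2 * (n + d * k) := by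
        rw [hτ, ← hν]
        ring
      linarith
    exact le_of_mul_le_mul_left h3 (mul_pos (by linarith) (by linarith))
  have hSdk : ν ^ 2 * d * k ≤ S ^ 2 := by
    rw [hν]
    have h1 : δ * (α * k) ≤ 1 := mul_le_one₀ hδ1 (by positivity) hαk
    calc δ * S ^ 2 * α * k = S ^ 2 * (δ * (α * k)) := by ring
      _ ≤ S ^ 2 * 1 := by gcongr
      _ = S ^ 2 := mul_one _
  have hSk : ν ^ 2 * k ≤ S ^ 2 := by
    refine le_trans ?_ hSdk
    gcongr
    exact le_mul_of_one_le_right (sq_nonneg _) hd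
  have hν1 : 1 ≤ ν ^ 2 := by nlinarith
  refine ⟨?_, ?_, hSk, ?_⟩
  · by_contra! h
    nlinarith
  · refine abs_le_of_sq_le_sq' ?_ hS.le |>.2
    nlinarith [sq_nonneg ν]
  · refine le_trans ?_ hSdk
    have h1 : (1 : ℝ) * d * 2 ≤ ν ^ 2 * d * k := by gcongr
    linarith

lemma one_sub_le_one_sub_add {d k n a b₁ b₂ b₃ b : ℝ} (hd : 0 ≤ d) (hk : 1 ≤ k) (hn : 1 ≤ n)
    (h₁ : b₁ ≤ k * n ^ (-4 : ℤ)) (h₂ : b₂ ≤ d * Real.exp (-0.3 * n)) (h₃ : b₃ ≤ Real.exp a)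
    (hb : b ≤ b₁ + b₂ + b₃) :
    1 - 4 * (k ^ 2 + k) * n ^ (-4 : ℤ) - 16 * d * n ^ 4 * Real.exp (-0.3 * n) -
      2 * k ^ 2 * Real.exp a ≤ 1 - b := by
  have h1 : k * n ^ (-4 : ℤ) ≤ 4 * (k ^ 2 + k) * n ^ (-4 : ℤ) := by
    gcongr
    nlinarith
  have h2 : d * Real.exp (-0.3 * n) ≤ 16 * d * n ^ 4 * Real.exp (-0.3 * n) := by
    have : 1 ≤ n ^ 4 := one_le_pow₀ hn
    gcongr
    nlinarith
  have h3 : Real.exp a ≤ 2 * k ^ 2 * Real.exp a :=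
    le_mul_of_one_le_left (Real.exp_nonneg _) (by nlinarith)
  linarith

end RobustClustering

end

theorem mainTheorem1 :
    ∃ C c₀ c₁ c₂ c₄ : ℝ, 0 < C ∧ 0 < c₀ ∧ 0 < c₁ ∧ 0 < c₂ ∧ 0 < c₄ ∧
      ∀ (Ω : Type*) [MeasurableSpace Ω] (μ : Measure Ω) [IsProbabilityMeasure μ]
        (d k n m : ℕ) (σ δ : ℝ) (θ : Fin k → RobustClustering.Pt d) (z : Fin n → Fin k)
        (w : Fin n → Ω → RobustClustering.Pt d),
        2 ≤ k → 0 < σ → 0 < δ → δ ≤ 1 →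
        (∀ i, Measurable (w i)) → iIndepFun w μ →
        (∀ i, RobustClustering.IsSubGaussian σ (w i) μ) →
        (m : ℝ) = n * RobustClustering.minFraction z * (1 - δ) →
        c₀ * Real.log n ≤ n * RobustClustering.minFraction z →
        C < √δ * RobustClustering.snr σ θ * √(RobustClustering.minFraction z / d) →
        ∃ E : Set Ω, MeasurableSet E ∧
          1 - 4 * ((k : ℝ) ^ 2 + k) * (n : ℝ) ^ (-4 : ℤ)
              - 16 * d * (n : ℝ) ^ 4 * Real.exp (-0.3 * n)
              - 2 * (k : ℝ) ^ 2 * Real.exp (-(RobustClustering.snr σ θ / 4)) ≤ μ.real E ∧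
          ∀ ω ∈ E, ∀ (x : Fin m → RobustClustering.Pt d)
            (zh : ℕ → Fin n ⊕ Fin m → Fin k) (θh : ℕ → Fin k → RobustClustering.Pt d),
            RobustClustering.IsHybridRun
              (RobustClustering.data θ z (fun i => w i ω) x) zh θh →
            ((RobustClustering.IsMedianCenters
                  (RobustClustering.data θ z (fun i => w i ω) x) (zh 0) (θh 0) ∧
                1 / 2 + c₁ / (RobustClustering.snr σ θ *
                    √(RobustClustering.minFraction z / d)) ^ 2
                  ≤ RobustClustering.correctProportion z (zh 0)) ∨
              RobustClustering.centerError θ (θh 0) ≤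
                1 / 2 - c₂ / √(√δ * RobustClustering.snr σ θ *
                    √(RobustClustering.minFraction z / (1 + d * k / n)))) →
            ∀ s, 2 ≤ s →
              RobustClustering.mislabelRate z (zh s) ≤
                Real.exp (-(1 / 2) *
                  (1 - c₄ / √(√δ * RobustClustering.snr σ θ *
                    √(RobustClustering.minFraction z / d))) *
                  RobustClustering.snr σ θ ^ 2) := by
  refine ⟨512, 4, 20, 1, 44, by norm_num, by norm_num, by norm_num, by norm_num, by norm_num, ?_⟩
  intro Ω _ μ _ d k n m σ δ θ z w hk hσ hδ hδ1 hmeas hind hw hm hlog hC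
  set α := RobustClustering.minFraction z with hα
  set S := RobustClustering.snr σ θ with hS
  set ν := √δ * S * √(α / d) with hν
  set τ := √δ * S * √(α / (1 + d * k / n)) with hτ
  have hν0 : 0 < ν := by linarith
  have hαd : 0 < α / d := by
    refine Real.sqrt_pos.1 (lt_of_le_of_ne (Real.sqrt_nonneg _) fun h => ?_)
    rw [hν, ← h, mul_zero] at hν0
    exact lt_irrefl _ hν0
  -- Degenerate cases drop out because division by zero is zero: `d = 0` makes `α / d` vanish, and
  -- `n = 0` makes `α` vanish.
  have hd : 0 < d := Nat.pos_of_ne_zero fun h => by simp [h] at hαd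
  have hd' : (1 : ℝ) ≤ d := by exact_mod_cast hd
  have hα0 : 0 < α := (div_pos_iff_of_pos_right (by linarith)).1 hαd
  have hn : 0 < n := Nat.pos_of_ne_zero fun h => by
    subst h
    have : Nonempty (Fin k) := ⟨⟨0, by omega⟩⟩
    simp [hα, RobustClustering.minFraction] at hα0
  have hn' : (0 : ℝ) < n := by exact_mod_cast hn
  have hk' : (2 : ℝ) ≤ k := by exact_mod_cast hk
  have hS0 : 0 < S := by
    have h1 := pos_of_mul_pos_left hν0 (Real.sqrt_nonneg _)
    exact pos_of_mul_pos_right h1 (Real.sqrt_nonneg _)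
  have hΔ : 0 < RobustClustering.separation θ := by
    rw [hS, RobustClustering.snr] at hS0
    exact (div_pos_iff_of_pos_right (by positivity)).1 hS0
  have hν2 : ν ^ 2 * d = δ * S ^ 2 * α := by
    rw [hν, mul_pow, mul_pow, Real.sq_sqrt hδ.le, Real.sq_sqrt hαd.le]
    field_simp
  have hτ2 : τ ^ 2 * (n + d * k) = δ * S ^ 2 * α * n := by
    rw [hτ, mul_pow, mul_pow, Real.sq_sqrt hδ.le, Real.sq_sqrt (by positivity)]
    field_simp
  have hαk : α * k ≤ 1 := by
    have := RobustClustering.card_mul_minFraction_le z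
    have h2 : (n : ℝ) * (α * k) ≤ n * 1 := by linarith
    exact le_of_mul_le_mul_left h2 hn'
  have hsize : ∀ g, (1 : ℝ) ≤ RobustClustering.trueSize z g := by
    intro g
    have h1 : (0 : ℝ) < RobustClustering.trueSize z g :=
      lt_of_lt_of_le (by positivity) (RobustClustering.minFraction_mul_le z g)
    exact_mod_cast Nat.succ_le_of_lt (by exact_mod_cast h1)
  have hkn : (k : ℝ) ≤ n := by
    have := sum_le_sum fun g (_ : g ∈ univ) => hsize g
    rw [RobustClustering.sum_trueSize, sum_const, card_fin, nsmul_eq_mul, mul_one] at this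
    exact this
  obtain ⟨hτ256, hνS, hSk, hSd⟩ := RobustClustering.parameter_bounds hδ1 hS0 hα0 hαk hk' hkn hd'
    hν2 hτ2 (by positivity) hC
  obtain ⟨B₁, hB₁m, hB₁, hq⟩ := RobustClustering.exists_quadraticBound (z := z) hσ hmeas hind hw hn
    fun g => hlog.trans (RobustClustering.minFraction_mul_le z g)
  obtain ⟨B₂, hB₂m, hB₂, hc⟩ := RobustClustering.exists_coordBound hσ hmeas hind hw
  obtain ⟨B₃, hB₃m, hB₃, hl⟩ := RobustClustering.exists_card_isLargeNoise_le (z := z) (ν := ν)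
    hσ hmeas hw hΔ (by linarith) hSd hn (by omega)
  refine ⟨(B₁ ∪ B₂ ∪ B₃)ᶜ, ((hB₁m.union hB₂m).union hB₃m).compl, ?_, ?_⟩
  · rw [probReal_compl_eq_one_sub ((hB₁m.union hB₂m).union hB₃m)]
    exact RobustClustering.one_sub_le_one_sub_add (by linarith) (by linarith)
      (by exact_mod_cast hn) hB₁ hB₂ hB₃
      ((measureReal_union_le _ _).trans (by gcongr; exact measureReal_union_le _ _))
  · intro ω hω x zh θh hrun hinit s hs
    simp only [Set.mem_compl_iff, Set.mem_union, not_or] at hω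
    obtain ⟨⟨hω₁, hω₂⟩, hω₃⟩ := hω
    -- The labels of step `t + 2` use the centers of step `t + 1`, the first ones known to be within
    -- `2Δ/ν`; hence `s ≥ 2`.
    obtain ⟨s, rfl⟩ : ∃ t, s = t + 1 + 1 := ⟨s - 2, by omega⟩
    have hcent := (hq ω hω₁).norm_sub_le_of_run (hc ω hω₂) hσ hΔ hδ (mul_pos hn' hα0) hd hm hν2 hτ2
      (by linarith) hτ256 hrun
      (hinit.imp (fun h => h.1.norm_sub_le_quarter (hc ω hω₂) hσ hΔ hα0 hn hd h.2)
        (RobustClustering.centerError_mul_le hΔ)) s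
    have hrate := RobustClustering.mislabelRate_le_of_card_isLargeNoise_le hσ hn
      (hrun.label (s + 1)) (by linarith) hΔ hcent (hl ω hω₃)
    have hexp := RobustClustering.exp_mul_mul_exp_le (by linarith) hνS hSk
      (Nat.cast_nonneg k)
    exact hrate.trans hexp
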